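/- Let $n>1$, $m\ge 1$ be integers. A set of $n$ rankable objects appears one at a time, at times $1,\dots,n$, in random order, all $n!$ orders being equally likely; only the relative ranks of the objects seen so far are observed. The object appearing at time $i$ is a candidate if it is the best of the first $i$ objects. If a candidate is chosen at time $i$, its duration is $T-i$, where $T$ is the arrival time of the next candidate after $i$ ($T=n+1$ if there is none). In the $m$-choice duration problem with acquisition cost $c$, one chooses successively, by stopping times with respect to the observed relative ranks, at most $m$ objects, all of them candidates; each chosen object yields its duration less the cost $c$, and the aim is to maximize the expected total net payoff. Let $U_i^{(1)}$ be the mean duration of an object appearing at time $i$, given that it is a candidate, let $H_j=\sum_{\ell=1}^j 1/\ell$ and $K(n)=\min\{i\ge1: H_n-H_i\le 1\}$, and suppose that $$0<c<U_{K(n)}^{(1)} .$$ Let $a$ and $b$ be the least and the greatest $i\in\{1,\dots,n\}$ with $U_i^{(1)}\ge c$. Then $1\le a\le K(n)\le b\le n$, and for $1\le i\le n$ we have $U_i^{(1)}\ge c$ if and only if $a\le i\le b$. Moreover, there are integers $s_1(c),\dots,s_m(c)$ in $\{1,\dots,b\}$ with the following properties. (i) Whenever there remain $k$ choices to be made ($1\le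 k\le m$), it is optimal to select the first candidate to appear at or after time $s_k(c)$ but no later than $b$. That is, the strategy given by this rule attains the maximal expected total net payoff among all strategies for the $m$-choice problem, and also, for all $1\le k\le m$, $1\le i\le n$ and all observations up to time $i$, the maximal conditional expected net payoff, given these observations, of at most $k$ choices made at times $i,\dots,n$. (ii) $s_1(c)\ge s_2(c)\ge\dots\ge s_m(c)\ge a$. (iii) The numbers $s_k(c)$ are determined as follows. Put, for $1\le i\le b$, $$G_i^{(1)}=H_n-H_{i-1}-\sum_{j=i+1}^{b}\frac{1}{j-1}\left(H_n-H_{j-1}\right)-\frac{c}{b},\qquad G_i^{(k)}=G_i^{(1)}+\sum_{j=\max(i+1,\,s_{k-1}(c))}^{b}\frac{1}{j-1}\,G_j^{(k-1)}\quad(2\le k\le m).$$ Then $s_k(c)=\min\{i\in\{1,\dots,b\}:G_i^{(k)}\ge 0\}$ for $1\le k\le m$. Furthermore, for $1\le k\le m$: if $G_i^{(k)}\ge0$ and $1\le i<b$, then $G_{i+1}^{(k)}\ge 0$; if $1\le i<s_k(c)$, then $G_{i+1}^{(k)}\ge G_i^{(k)}$; and if $k<m$, then $G_i^{(k+1)}\ge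 G_i^{(k)}$ for $1\le i\le b$. -/

import Mathlib

namespace DurationProblem

/-! A ranking of `n` objects presented at the times `1, …, n` is a permutation `σ` of `Fin n`:
`σ t` is the absolute rank (the smaller, the better) of the object presented at time `t + 1`.
All `n!` permutations are equally likely. -/

/-- The relative rank, among the objects presented so far, of the object presented at time
`t + 1`; it lies in `{1, …, t + 1}`. -/
def relRank {n : ℕ} (σ : Equiv.Perm (Fin n)) (t : Fin n) : ℕ :=
  (Finset.univ.filter fun u : Fin n => u ≤ t ∧ σ u ≤ σ t).card

/-- The object presented at time `i` (with `1 ≤ i ≤ n`) is a candidate: it is relatively best. -/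
def IsCandidate {n : ℕ} (σ : Equiv.Perm (Fin n)) (i : ℕ) : Prop :=
  ∃ t : Fin n, (t : ℕ) + 1 = i ∧ relRank σ t = 1

/-- The arrival time of the first candidate after time `i`, and `n + 1` if there is none. -/
noncomputable def nextCandidate {n : ℕ} (σ : Equiv.Perm (Fin n)) (i : ℕ) : ℕ :=
  sInf {j : ℕ | i < j ∧ (IsCandidate σ j ∨ j = n + 1)}

/-- The length of time for which an object chosen at time `i` remains a candidate. -/
noncomputable def duration {n : ℕ} (σ : Equiv.Perm (Fin n)) (i : ℕ) : ℝ :=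
  (nextCandidate σ i : ℝ) - (i : ℝ)

/-- The mean of `f` over a set `S` of rankings: the expectation of `f` conditional on `S`, and
the plain expectation for `S = univ`. -/
noncomputable def mean {n : ℕ} (S : Finset (Equiv.Perm (Fin n)))
    (f : Equiv.Perm (Fin n) → ℝ) : ℝ :=
  (∑ σ ∈ S, f σ) / (S.card : ℝ)

open Classical in
/-- `U i`: the mean duration of the object presented at time `i`, given that it is a
candidate. -/
noncomputable def meanDuration (n i : ℕ) : ℝ :=
  mean (Finset.univ.filter fun σ : Equiv.Perm (Fin n) => IsCandidate σ i) fun σ => duration σ i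

/-- The observations up to time `i`: the relative ranks of the first `i` objects. -/
def history {n : ℕ} (i : ℕ) (σ : Equiv.Perm (Fin n)) : {t : Fin n // (t : ℕ) < i} → ℕ :=
  fun t => relRank σ t.1

/-- The filtration generated by the relative ranks. -/
def rankFiltration (n : ℕ) :
    MeasureTheory.Filtration ℕ (⊤ : MeasurableSpace (Equiv.Perm (Fin n))) where
  seq i := MeasurableSpace.comap (history i) ⊤
  mono' := by
    rintro i j hij _ ⟨S, -, rfl⟩
    exact ⟨(fun (h : {t : Fin n // (t : ℕ) < j} → ℕ) (t : {t : Fin n // (t : ℕ) < i}) =>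
      h ⟨t.1, lt_of_lt_of_le t.2 hij⟩) ⁻¹' S, trivial, rfl⟩
  le' _ := le_top

open Classical in
/-- The rankings that produce the same observations up to time `i` as `σ₀`. -/
noncomputable def sameHistory {n : ℕ} (i : ℕ) (σ₀ : Equiv.Perm (Fin n)) :
    Finset (Equiv.Perm (Fin n)) :=
  Finset.univ.filter fun σ => history i σ = history i σ₀

/-- The strategies for making at most `k` choices at times `i, i + 1, …, n`: vectors of stopping
times with respect to the relative ranks, at which candidates are chosen one after the other.
The value `⊤` means that the choice is not made. -/
structure IsAdmissible {n : ℕ} (k i : ℕ)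
    (τ : Fin k → Equiv.Perm (Fin n) → WithTop ℕ) : Prop where
  stopping : ∀ l, MeasureTheory.IsStoppingTime (rankFiltration n) (τ l)
  candidate : ∀ l σ (j : ℕ), τ l σ = (j : WithTop ℕ) → IsCandidate σ j
  start : ∀ l σ, (i : WithTop ℕ) ≤ τ l σ
  increasing : ∀ l l' σ, l < l' → τ l σ < τ l' σ ∨ (τ l σ = ⊤ ∧ τ l' σ = ⊤)

/-- The net payoff of one choice: its duration less the acquisition cost `c`; nothing is gained
or paid if the choice is not made. -/
noncomputable def netPayoff {n : ℕ} (c : ℝ) (σ : Equiv.Perm (Fin n)) : WithTop ℕ → ℝ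
  | ⊤ => 0
  | (j : ℕ) => duration σ j - c

/-- The total net payoff of a vector of choices. -/
noncomputable def totalPayoff {n k : ℕ} (c : ℝ)
    (τ : Fin k → Equiv.Perm (Fin n) → WithTop ℕ) (σ : Equiv.Perm (Fin n)) : ℝ :=
  ∑ l, netPayoff c σ (τ l σ)

/-- The first candidate at a time `j` with `lo ≤ j ≤ hi`, and `⊤` if there is none. -/
noncomputable def firstCandidate {n : ℕ} (σ : Equiv.Perm (Fin n)) (lo hi : ℕ) : WithTop ℕ :=
  sInf {x : WithTop ℕ | ∃ j : ℕ, x = (j : WithTop ℕ) ∧ lo ≤ j ∧ j ≤ hi ∧ IsCandidate σ j}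

/-- The choices made from time `i` on, with `k` choices left, by the threshold strategy: whenever
`k` choices are left, choose the next candidate at or after time `s k` but no later than `b`. -/
noncomputable def thresholdTimes {n : ℕ} (s : ℕ → ℕ) (b : ℕ) (σ : Equiv.Perm (Fin n)) :
    (k : ℕ) → (i : ℕ) → Fin k → WithTop ℕ
  | 0, _ => Fin.elim0
  | k + 1, i =>
    Fin.cons (firstCandidate σ (max i (s (k + 1))) b)
      (match firstCandidate σ (max i (s (k + 1))) b with
        | ⊤ => fun _ => ⊤
        | (j : ℕ) => thresholdTimes s b σ k (j + 1))

/-- The threshold strategy as a vector of random times. -/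
noncomputable def thresholdStrategy {n : ℕ} (s : ℕ → ℕ) (b k i : ℕ) :
    Fin k → Equiv.Perm (Fin n) → WithTop ℕ :=
  fun l σ => thresholdTimes s b σ k i l

/-- `K(n) = min {i ≥ 1 : H_n - H_i ≤ 1}`, with `H` the harmonic numbers. -/
noncomputable def peakTime (n : ℕ) : ℕ :=
  sInf {i : ℕ | 1 ≤ i ∧ (harmonic n : ℝ) - (harmonic i : ℝ) ≤ 1}

/-- `a(n, c)`: the first time at which choosing a candidate has nonnegative mean net payoff. -/
noncomputable def firstTime (n : ℕ) (c : ℝ) : ℕ :=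
  sInf {i : ℕ | 1 ≤ i ∧ i ≤ n ∧ 0 ≤ meanDuration n i - c}

/-- `b(n, c)`: the last time at which choosing a candidate has nonnegative mean net payoff. -/
noncomputable def lastTime (n : ℕ) (c : ℝ) : ℕ :=
  sSup {i : ℕ | 1 ≤ i ∧ i ≤ n ∧ 0 ≤ meanDuration n i - c}

/-- `G^{(k)}_i` for `1 ≤ i ≤ N` and `k ≥ 1`, from `G^{(1)}` and the numbers `s_1, s_2, …`. (The
value at `k = 0` is a dummy.) -/
noncomputable def gain (N : ℕ) (G₁ : ℕ → ℝ) (s : ℕ → ℕ) : ℕ → ℕ → ℝ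
  | 0, _ => 0
  | 1, i => G₁ i
  | k + 2, i =>
    G₁ i + ∑ j ∈ Finset.Icc (max (i + 1) (s (k + 1))) N, 1 / ((j : ℝ) - 1) * gain N G₁ s (k + 1) j

/-- `s_1, …, s_m` are the critical numbers generated by `G^{(1)}` on `{1, …, N}`. -/
structure IsCriticalSequence (N m : ℕ) (G₁ : ℕ → ℝ) (s : ℕ → ℕ) : Prop where
  nonneg_succ : ∀ k, 1 ≤ k → k ≤ m → ∀ i, 1 ≤ i → i < N →
    0 ≤ gain N G₁ s k i → 0 ≤ gain N G₁ s k (i + 1)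
  le_next : ∀ k, 1 ≤ k → k < m → ∀ i, 1 ≤ i → i ≤ N → gain N G₁ s k i ≤ gain N G₁ s (k + 1) i
  le_succ : ∀ k, 1 ≤ k → k ≤ m → ∀ i, 1 ≤ i → i < s k → gain N G₁ s k i ≤ gain N G₁ s k (i + 1)
  isLeast : ∀ k, 1 ≤ k → k ≤ m → IsLeast {i : ℕ | 1 ≤ i ∧ i ≤ N ∧ 0 ≤ gain N G₁ s k i} (s k)

/-- `G^{(1)}_i` for the duration problem with acquisition cost `c`, where `b = b(n, c)`. -/
noncomputable def acquisitionGain (n : ℕ) (c : ℝ) (i : ℕ) : ℝ :=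
  (harmonic n : ℝ) - (harmonic (i - 1) : ℝ)
    - ∑ j ∈ Finset.Icc (i + 1) (lastTime n c),
        1 / ((j : ℝ) - 1) * ((harmonic n : ℝ) - (harmonic (j - 1) : ℝ))
    - c / (lastTime n c : ℝ)

end DurationProblem

open DurationProblem

/-!
Given the observations up to time `i`, all `n! / i!` compatible rankings are equally likely; hence
the next object is a candidate with probability `1 / (i + 1)`, whatever has been observed, and the
mean payoff `u i` of a candidate chosen at time `i` depends on `i` only. Backward induction
therefore runs over the pairs (number `k` of choices left, time `i`). As long as the thresholds are
followed, the value before time `i` is the sum of `G^{(k)}_j` over `max (i, s_k) ≤ j ≤ b`, and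
`i * G^{(k)}_i` is what choosing a candidate at a time `i ≥ s_k` gains over passing it over. When
`u` increases and then decreases, each `G^{(k)}` changes sign only once, from negative to
nonnegative, so that following the thresholds is optimal. For durations,
`U_i = i * (H_n - H_{i-1})` has the increments `H_n - H_i - 1`, whose sign changes at `K(n)`.
-/

namespace DurationProblem

open Finset Nat

variable {n : ℕ}

section RelativeRanks

lemma strictMonoOn_card_filter_le {α : Type*} [LinearOrder α] (A : Finset α) :
    StrictMonoOn (fun x => #{y ∈ A | y ≤ x}) A := by
  intro x _ y hy hxy
  refine card_lt_card ((ssubset_iff_of_subset ?_).2 ⟨y, ?_, ?_⟩)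
  · exact monotone_filter_right A fun _ _ hz => hz.trans hxy.le
  · exact mem_filter.2 ⟨hy, le_rfl⟩
  · exact fun h => hxy.not_ge (mem_filter.1 h).2

lemma relRank_eq_card_image (σ : Equiv.Perm (Fin n)) (t : Fin n) :
    relRank σ t = #{y ∈ (Iic t).image σ | y ≤ σ t} := by
  rw [filter_image, card_image_of_injective _ σ.injective, relRank]
  congr 1
  ext u
  simp

lemma relRank_mem_Icc (σ : Equiv.Perm (Fin n)) (t : Fin n) :
    relRank σ t ∈ Icc 1 ((t : ℕ) + 1) := by
  refine mem_Icc.2 ⟨card_pos.2 ⟨t, by simp⟩, ?_⟩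
  calc relRank σ t ≤ #(Iic t) := card_le_card fun u hu => mem_Iic.2 (mem_filter.1 hu).2.1
    _ = t + 1 := Fin.card_Iic t

-- Downward induction on `t`: once `σ` is known after time `t`, so is the set of absolute ranks
-- taken up to time `t`, and in it `σ t` is the element at position `relRank σ t`.
lemma relRank_injective :
    Function.Injective (relRank : Equiv.Perm (Fin n) → Fin n → ℕ) := by
  intro σ σ' h
  ext1 t
  induction t using WellFoundedGT.induction with
  | ind t ih =>
    have hlater : σ '' Set.Ioi t = σ' '' Set.Ioi t := Set.image_congr ih
    have himage : (Iic t).image σ = (Iic t).image σ' := coe_injective <| by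
      rw [coe_image, coe_image, coe_Iic, ← Set.compl_Ioi, Set.image_compl_eq σ.bijective,
        Set.image_compl_eq σ'.bijective, hlater]
    have hmem : ∀ ρ : Equiv.Perm (Fin n), ρ t ∈ (Iic t).image ρ := fun ρ =>
      mem_image_of_mem ρ (mem_Iic.2 le_rfl)
    refine (strictMonoOn_card_filter_le ((Iic t).image σ)).injOn (hmem σ) ?_ ?_
    · exact himage ▸ hmem σ'
    · simpa only [relRank_eq_card_image, ← himage] using congrFun h t

lemma image_relRank_univ :
    univ.image (relRank (n := n)) = Fintype.piFinset fun t : Fin n => Icc 1 ((t : ℕ) + 1) := by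
  refine eq_of_subset_of_card_le ?_ (le_of_eq ?_)
  · exact image_subset_iff.2 fun σ _ => Fintype.mem_piFinset.2 (relRank_mem_Icc σ)
  · rw [card_image_of_injective _ relRank_injective, Finset.card_univ, Fintype.card_perm,
      Fintype.card_fin, Fintype.card_piFinset]
    simp only [Nat.card_Icc, add_tsub_cancel_right]
    rw [Fin.prod_univ_eq_prod_range (fun t => t + 1) n, prod_range_add_one_eq_factorial]

lemma isCandidate_succ_iff {i : ℕ} (hi : i < n) {σ : Equiv.Perm (Fin n)} :
    IsCandidate σ (i + 1) ↔ relRank σ ⟨i, hi⟩ = 1 := by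
  refine ⟨?_, fun h => ⟨⟨i, hi⟩, rfl, h⟩⟩
  rintro ⟨t, ht, hr⟩
  obtain rfl : t = ⟨i, hi⟩ := Fin.ext (Nat.succ_injective ht)
  exact hr

lemma IsCandidate.mem_Icc {σ : Equiv.Perm (Fin n)} {i : ℕ} (h : IsCandidate σ i) :
    i ∈ Set.Icc 1 n := by
  obtain ⟨t, rfl, -⟩ := h
  exact ⟨Nat.succ_pos t, t.2⟩

end RelativeRanks

section History

variable {i j : ℕ} {σ σ' σ₀ : Equiv.Perm (Fin n)}

lemma history_eq_iff :
    history i σ = history i σ' ↔ ∀ t : Fin n, (t : ℕ) < i → relRank σ t = relRank σ' t :=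
  ⟨fun h t ht => congrFun h ⟨t, ht⟩, fun h => funext fun t => h t.1 t.2⟩

lemma history_succ_eq_iff (hi : i < n) :
    history (i + 1) σ = history (i + 1) σ' ↔
      history i σ = history i σ' ∧ relRank σ ⟨i, hi⟩ = relRank σ' ⟨i, hi⟩ := by
  simp only [history_eq_iff, Nat.lt_succ_iff_lt_or_eq]
  refine ⟨fun h => ⟨fun t ht => h t (Or.inl ht), h _ (Or.inr rfl)⟩, ?_⟩
  rintro ⟨hlt, heq⟩ t (ht | rfl)
  exacts [hlt t ht, heq]

lemma history_eq_of_le (hij : i ≤ j) (h : history j σ = history j σ') :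
    history i σ = history i σ' :=
  history_eq_iff.2 fun t ht => history_eq_iff.1 h t (ht.trans_le hij)

lemma isCandidate_congr (hij : i ≤ j) (h : history j σ = history j σ') :
    IsCandidate σ i ↔ IsCandidate σ' i := by
  refine exists_congr fun t => and_congr_right fun ht => ?_
  rw [history_eq_iff.1 h t (by omega)]

lemma mem_sameHistory : σ ∈ sameHistory i σ₀ ↔ history i σ = history i σ₀ := by
  simp [sameHistory]

lemma sameHistory_nonempty (i : ℕ) (σ₀ : Equiv.Perm (Fin n)) : (sameHistory i σ₀).Nonempty :=
  ⟨σ₀, mem_sameHistory.2 rfl⟩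

lemma sameHistory_eq (h : σ ∈ sameHistory i σ₀) : sameHistory i σ = sameHistory i σ₀ := by
  ext ρ
  rw [mem_sameHistory, mem_sameHistory, mem_sameHistory.1 h]

lemma sameHistory_subset (hij : i ≤ j) (h : σ ∈ sameHistory i σ₀) :
    sameHistory j σ ⊆ sameHistory i σ₀ := fun _ hρ =>
  mem_sameHistory.2 ((history_eq_of_le hij (mem_sameHistory.1 hρ)).trans (mem_sameHistory.1 h))

lemma isCandidate_iff_of_mem_sameHistory (h : σ ∈ sameHistory i σ₀) :
    IsCandidate σ i ↔ IsCandidate σ₀ i :=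
  isCandidate_congr le_rfl (mem_sameHistory.1 h)

lemma sameHistory_one (σ₀ : Equiv.Perm (Fin n)) : sameHistory 1 σ₀ = univ := by
  refine eq_univ_iff_forall.2 fun σ => mem_sameHistory.2 (history_eq_iff.2 fun t ht => ?_)
  have hσ := Finset.mem_Icc.1 (relRank_mem_Icc σ t)
  have hσ₀ := Finset.mem_Icc.1 (relRank_mem_Icc σ₀ t)
  omega

lemma image_relRank_sameHistory (i : ℕ) (σ₀ : Equiv.Perm (Fin n)) :
    (sameHistory i σ₀).image relRank = Fintype.piFinset fun t : Fin n =>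
      if (t : ℕ) < i then {relRank σ₀ t} else Icc 1 ((t : ℕ) + 1) := by
  ext r
  rw [mem_image, Fintype.mem_piFinset]
  constructor
  · rintro ⟨σ, hσ, rfl⟩ t
    split_ifs with ht
    · exact mem_singleton.2 (history_eq_iff.1 (mem_sameHistory.1 hσ) t ht)
    · exact relRank_mem_Icc σ t
  · intro hr
    have hr_univ : r ∈ univ.image relRank := by
      rw [image_relRank_univ, Fintype.mem_piFinset]
      intro t
      have ht := hr t
      split_ifs at ht
      exacts [mem_singleton.1 ht ▸ relRank_mem_Icc σ₀ t, ht]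
    obtain ⟨σ, -, rfl⟩ := mem_image.1 hr_univ
    refine ⟨σ, mem_sameHistory.2 (history_eq_iff.2 fun t ht => ?_), rfl⟩
    simpa only [if_pos ht, mem_singleton] using hr t

lemma card_sameHistory_mul_factorial (hi : i ≤ n) (σ₀ : Equiv.Perm (Fin n)) :
    #(sameHistory i σ₀) * i ! = n ! := by
  have hfactor : ∀ t : Fin n,
      #(if (t : ℕ) < i then ({relRank σ₀ t} : Finset ℕ) else Icc 1 ((t : ℕ) + 1))
        = if (t : ℕ) < i then 1 else (t : ℕ) + 1 := by
    intro t
    split_ifs <;> simp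
  have hcard : #(sameHistory i σ₀) = ∏ t ∈ Ico i n, (t + 1) := by
    rw [← card_image_of_injective _ relRank_injective, image_relRank_sameHistory,
      Fintype.card_piFinset, prod_congr rfl fun t _ => hfactor t,
      Fin.prod_univ_eq_prod_range (fun t => if t < i then 1 else t + 1) n,
      ← prod_range_mul_prod_Ico _ hi, prod_eq_one fun t ht => if_pos (mem_range.1 ht), one_mul]
    exact prod_congr rfl fun t ht => if_neg (Finset.mem_Ico.1 ht).1.not_gt
  rw [hcard, mul_comm, ← prod_range_add_one_eq_factorial, prod_range_mul_prod_Ico _ hi,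
    prod_range_add_one_eq_factorial]

lemma exists_mem_sameHistory_isCandidate (hi : i < n) (σ₀ : Equiv.Perm (Fin n)) :
    ∃ σ ∈ sameHistory i σ₀, IsCandidate σ (i + 1) := by
  have hmem : (fun t : Fin n => if (t : ℕ) < i then relRank σ₀ t else 1)
      ∈ (sameHistory i σ₀).image relRank := by
    rw [image_relRank_sameHistory, Fintype.mem_piFinset]
    intro t
    split_ifs <;> simp
  obtain ⟨σ, hσ, hrank⟩ := mem_image.1 hmem
  exact ⟨σ, hσ, (isCandidate_succ_iff hi).2 (by rw [hrank]; simp)⟩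

open Classical in
lemma card_isCandidate_mul (hi : i < n) (σ₀ : Equiv.Perm (Fin n)) :
    #{σ ∈ sameHistory i σ₀ | IsCandidate σ (i + 1)} * (i + 1) = #(sameHistory i σ₀) := by
  obtain ⟨σ, hσ, hcand⟩ := exists_mem_sameHistory_isCandidate hi σ₀
  have hclass : {ρ ∈ sameHistory i σ₀ | IsCandidate ρ (i + 1)} = sameHistory (i + 1) σ := by
    ext ρ
    rw [mem_filter, ← sameHistory_eq hσ, mem_sameHistory, mem_sameHistory,
      history_succ_eq_iff hi, (isCandidate_succ_iff hi).1 hcand, isCandidate_succ_iff hi]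
  have hcount : #(sameHistory (i + 1) σ) * (i + 1) * i ! = #(sameHistory i σ₀) * i ! := by
    rw [mul_assoc, ← Nat.factorial_succ, card_sameHistory_mul_factorial hi,
      card_sameHistory_mul_factorial hi.le]
  rw [hclass]
  exact Nat.eq_of_mul_eq_mul_right (Nat.factorial_pos i) hcount

end History

section Mean

variable {S : Finset (Equiv.Perm (Fin n))} {f g : Equiv.Perm (Fin n) → ℝ}

lemma mean_congr (h : ∀ σ ∈ S, f σ = g σ) : mean S f = mean S g := by
  rw [mean, mean, sum_congr rfl h]

lemma mean_mono (h : ∀ σ ∈ S, f σ ≤ g σ) : mean S f ≤ mean S g :=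
  div_le_div_of_nonneg_right (sum_le_sum h) (Nat.cast_nonneg _)

lemma mean_const (hS : S.Nonempty) (x : ℝ) : mean S (fun _ => x) = x := by
  have hcard : (#S : ℝ) ≠ 0 := Nat.cast_ne_zero.2 hS.card_ne_zero
  rw [mean, sum_const, nsmul_eq_mul, mul_div_cancel_left₀ x hcard]

lemma mean_eq_of_forall (hS : S.Nonempty) {x : ℝ} (h : ∀ σ ∈ S, f σ = x) : mean S f = x := by
  rw [mean_congr h, mean_const hS]

lemma mean_add : mean S (fun σ => f σ + g σ) = mean S f + mean S g := by
  rw [mean, mean, mean, sum_add_distrib, add_div]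

lemma mean_mean_sameHistory {j : ℕ} (hS : ∀ σ ∈ S, sameHistory j σ ⊆ S)
    (f : Equiv.Perm (Fin n) → ℝ) :
    mean S (fun σ => mean (sameHistory j σ) f) = mean S f := by
  have hswap : ∀ σ ρ, σ ∈ S ∧ ρ ∈ sameHistory j σ ↔ σ ∈ sameHistory j ρ ∧ ρ ∈ S := by
    intro σ ρ
    rw [mem_sameHistory, mem_sameHistory]
    exact ⟨fun h => ⟨h.2.symm, hS σ h.1 (mem_sameHistory.2 h.2)⟩,
      fun h => ⟨hS ρ h.2 (mem_sameHistory.2 h.1), h.1.symm⟩⟩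
  rw [mean, mean]
  congr 1
  simp only [mean, sum_div]
  rw [sum_comm' hswap]
  refine sum_congr rfl fun ρ _ => ?_
  calc ∑ σ ∈ sameHistory j ρ, f ρ / #(sameHistory j σ)
      = ∑ _ ∈ sameHistory j ρ, f ρ / #(sameHistory j ρ) :=
        sum_congr rfl fun σ hσ => by rw [sameHistory_eq hσ]
    _ = f ρ := by
        rw [← sum_div]
        exact mean_const (sameHistory_nonempty j ρ) (f ρ)

open Classical in
lemma mean_ite_isCandidate {i : ℕ} (hi : i < n) (σ₀ : Equiv.Perm (Fin n)) (x y : ℝ) :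
    mean (sameHistory i σ₀) (fun σ => if IsCandidate σ (i + 1) then x else y)
      = y + (x - y) / (i + 1 : ℝ) := by
  have hcard : (#(sameHistory i σ₀) : ℝ)
      = #{σ ∈ sameHistory i σ₀ | IsCandidate σ (i + 1)} * (i + 1) := by
    exact_mod_cast (card_isCandidate_mul hi σ₀).symm
  have hpos : (#{σ ∈ sameHistory i σ₀ | IsCandidate σ (i + 1)} : ℝ) ≠ 0 :=
    left_ne_zero_of_mul <| hcard ▸
      Nat.cast_ne_zero.2 (sameHistory_nonempty i σ₀).card_ne_zero
  have hsplit : ∀ σ : Equiv.Perm (Fin n), (if IsCandidate σ (i + 1) then x else y)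
      = y + if IsCandidate σ (i + 1) then x - y else 0 := fun σ => by split_ifs <;> ring
  simp only [hsplit]
  rw [mean_add, mean_const (sameHistory_nonempty i σ₀), mean, ← sum_filter, sum_const,
    nsmul_eq_mul, hcard, mul_div_mul_left _ _ hpos]

end Mean

section Duration

variable {i : ℕ} {σ : Equiv.Perm (Fin n)}

lemma nextCandidate_eq (h : IsCandidate σ (i + 1) ∨ i + 1 = n + 1) :
    nextCandidate σ i = i + 1 := by
  refine le_antisymm (Nat.sInf_le ⟨Nat.lt_succ_self i, h⟩) ?_
  exact le_csInf ⟨i + 1, Nat.lt_succ_self i, h⟩ fun j hj => hj.1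

lemma nextCandidate_succ (hi : i < n) (h : ¬ IsCandidate σ (i + 1)) :
    nextCandidate σ i = nextCandidate σ (i + 1) := by
  unfold nextCandidate
  congr 1
  ext j
  refine and_congr_left fun hj => ⟨fun hij => lt_of_le_of_ne hij ?_, fun hij => by omega⟩
  rintro rfl
  rcases hj with hj | hj
  exacts [h hj, hi.ne (Nat.succ_injective hj)]

lemma duration_last (σ : Equiv.Perm (Fin n)) : duration σ n = 1 := by
  rw [duration, nextCandidate_eq (Or.inr rfl), Nat.cast_succ, add_sub_cancel_left]

open Classical in
lemma duration_eq_ite (hi : i < n) (σ : Equiv.Perm (Fin n)) :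
    duration σ i = 1 + if IsCandidate σ (i + 1) then 0 else duration σ (i + 1) := by
  unfold duration
  split_ifs with h
  · rw [nextCandidate_eq (Or.inl h), Nat.cast_succ]
    ring
  · rw [nextCandidate_succ hi h, Nat.cast_succ]
    ring

lemma mul_harmonic_sub_pred (n : ℕ) (hi : 1 ≤ i) :
    (i : ℝ) * (harmonic n - harmonic (i - 1)) = 1 + i * (harmonic n - harmonic i) := by
  obtain ⟨i, rfl⟩ := Nat.exists_eq_add_of_le' hi
  have hpos : (i : ℝ) + 1 ≠ 0 := by positivity
  rw [Nat.add_sub_cancel, harmonic_succ]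
  push_cast
  field_simp
  ring

open Classical in
lemma mean_sameHistory_duration (hi1 : 1 ≤ i) (hin : i ≤ n) (σ₀ : Equiv.Perm (Fin n)) :
    mean (sameHistory i σ₀) (fun σ => duration σ i)
      = i * ((harmonic n : ℝ) - harmonic (i - 1)) := by
  induction hin using Nat.decreasingInduction generalizing σ₀ with
  | self =>
    rw [mean_eq_of_forall (sameHistory_nonempty n σ₀) fun σ _ => duration_last σ,
      mul_harmonic_sub_pred n hi1, sub_self, mul_zero, add_zero]
  | of_succ i hlt ih =>
    set y : ℝ := (i + 1 : ℕ) * (harmonic n - harmonic i) with hy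
    have hnext : ∀ σ : Equiv.Perm (Fin n), mean (sameHistory (i + 1) σ) (fun ρ => duration ρ i)
        = 1 + if IsCandidate σ (i + 1) then 0 else y := by
      intro σ
      have hcongr : ∀ ρ ∈ sameHistory (i + 1) σ,
          duration ρ i = 1 + if IsCandidate σ (i + 1) then 0 else duration ρ (i + 1) := by
        intro ρ hρ
        rw [duration_eq_ite hlt, isCandidate_iff_of_mem_sameHistory hρ]
      have hclass := sameHistory_nonempty (i + 1) σ
      rw [mean_congr hcongr, mean_add, mean_const hclass]
      split_ifs
      exacts [congrArg _ (mean_const hclass 0), congrArg _ (ih (Nat.le_add_left 1 i) σ)]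
    rw [← mean_mean_sameHistory fun σ => sameHistory_subset (Nat.le_succ i),
      mean_congr fun σ _ => hnext σ, mean_add, mean_const (sameHistory_nonempty i σ₀),
      mean_ite_isCandidate hlt, mul_harmonic_sub_pred n hi1, hy]
    push_cast
    field_simp
    ring

lemma meanDuration_eq (hi1 : 1 ≤ i) (hin : i ≤ n) :
    meanDuration n i = i * ((harmonic n : ℝ) - harmonic (i - 1)) := by
  classical
  obtain ⟨i, rfl⟩ := Nat.exists_eq_add_of_le' hi1
  obtain ⟨σ, -, hσ⟩ := exists_mem_sameHistory_isCandidate hin (1 : Equiv.Perm (Fin n))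
  rw [meanDuration, ← mean_mean_sameHistory (j := i + 1)]
  · exact mean_eq_of_forall ⟨σ, by simpa using hσ⟩ fun σ _ => mean_sameHistory_duration hi1 hin σ
  · intro σ hσ ρ hρ
    rw [mem_filter] at hσ ⊢
    exact ⟨mem_univ ρ, (isCandidate_iff_of_mem_sameHistory hρ).2 hσ.2⟩

lemma mean_sameHistory_duration_eq_meanDuration (hi1 : 1 ≤ i) (hin : i ≤ n)
    (σ₀ : Equiv.Perm (Fin n)) :
    mean (sameHistory i σ₀) (fun σ => duration σ i) = meanDuration n i := by
  rw [mean_sameHistory_duration hi1 hin, meanDuration_eq hi1 hin]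

lemma meanDuration_succ_sub (hi1 : 1 ≤ i) (hin : i < n) :
    meanDuration n (i + 1) - meanDuration n i = harmonic n - harmonic i - 1 := by
  rw [meanDuration_eq (Nat.le_add_left 1 i) hin, meanDuration_eq hi1 hin.le,
    mul_harmonic_sub_pred n hi1, Nat.add_sub_cancel]
  push_cast
  ring

end Duration

section CriticalNumbers

variable {N K m k i : ℕ} {G : ℕ → ℝ} {s : ℕ → ℕ}

lemma gain_succ (N : ℕ) (G : ℕ → ℝ) (s : ℕ → ℕ) (k i : ℕ) :
    gain N G s (k + 1) i
      = G i + ∑ j ∈ Icc (max (i + 1) (s k)) N, 1 / ((j : ℝ) - 1) * gain N G s k j := by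
  cases k with
  | zero => simp only [gain, mul_zero, sum_const_zero, add_zero]
  | succ k => rw [gain]

lemma gain_congr {s' : ℕ → ℕ} (h : ∀ l < k, s l = s' l) (i : ℕ) :
    gain N G s k i = gain N G s' k i := by
  induction k generalizing i with
  | zero => rfl
  | succ k ih =>
    rw [gain_succ, gain_succ, h k k.lt_succ_self]
    simp only [ih fun l hl => h l (hl.trans k.lt_succ_self)]

/-- The critical numbers generated by `G`: given those of smaller index, `criticalNumber N G k` is
the least `i ∈ {1, …, N}` with nonnegative gain `G^{(k)}_i`. -/
noncomputable def criticalNumber (N : ℕ) (G : ℕ → ℝ) (k : ℕ) : ℕ :=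
  sInf {i : ℕ | 1 ≤ i ∧ i ≤ N ∧
    0 ≤ gain N G (fun l => if _ : l < k then criticalNumber N G l else 0) k i}
termination_by k

lemma criticalNumber_eq_sInf (N : ℕ) (G : ℕ → ℝ) (k : ℕ) :
    criticalNumber N G k
      = sInf {i : ℕ | 1 ≤ i ∧ i ≤ N ∧ 0 ≤ gain N G (criticalNumber N G) k i} := by
  rw [criticalNumber]
  simp only [gain_congr fun l (hl : l < k) =>
    (dif_pos hl : (if _ : l < k then criticalNumber N G l else 0) = _)]

namespace IsCriticalSequence

lemma gain_nonneg (h : IsCriticalSequence N m G s) (hk : 1 ≤ k) (hkm : k ≤ m) (hi : s k ≤ i)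
    (hiN : i ≤ N) : 0 ≤ gain N G s k i := by
  obtain ⟨hs1, -, hs0⟩ := (h.isLeast k hk hkm).1
  induction i, hi using Nat.le_induction with
  | base => exact hs0
  | succ i hi ih =>
    exact h.nonneg_succ k hk hkm i (hs1.trans hi) hiN (ih ((Nat.le_succ i).trans hiN))

lemma gain_neg (h : IsCriticalSequence N m G s) (hk : 1 ≤ k) (hkm : k ≤ m) (hi : 1 ≤ i)
    (his : i < s k) : gain N G s k i < 0 := by
  obtain ⟨⟨-, hsN, -⟩, hle⟩ := h.isLeast k hk hkm
  exact not_le.1 fun h0 => his.not_ge (hle ⟨hi, his.le.trans hsN, h0⟩)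

lemma apply_succ_le (h : IsCriticalSequence N m G s) (hk : 1 ≤ k) (hkm : k < m) :
    s (k + 1) ≤ s k := by
  obtain ⟨hs1, hsN, hs0⟩ := (h.isLeast k hk hkm.le).1
  exact (h.isLeast (k + 1) (Nat.le_add_left 1 k) hkm).2
    ⟨hs1, hsN, hs0.trans (h.le_next k hk hkm _ hs1 hsN)⟩

lemma antitoneOn (h : IsCriticalSequence N m G s) : AntitoneOn s (Set.Icc 1 m) :=
  antitoneOn_of_add_one_le Set.ordConnected_Icc fun _ _ hk hk' => h.apply_succ_le hk.1 hk'.2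

lemma apply_le (h : IsCriticalSequence N m G s) (hk : 1 ≤ k) (hkm : k ≤ m) (hK : 1 ≤ K)
    (hKN : K ≤ N) (hGK : 0 ≤ G K) : s k ≤ K :=
  (h.antitoneOn ⟨le_rfl, hk.trans hkm⟩ ⟨hk, hkm⟩ hk).trans
    ((h.isLeast 1 le_rfl (hk.trans hkm)).2 ⟨hK, hKN, hGK⟩)

lemma sum_gain_le_sum_gain_succ (h : IsCriticalSequence N m G s) (hkm : k < m) (i : ℕ)
    {w : ℕ → ℝ} (hw : ∀ j, 1 ≤ j → 0 ≤ w j) :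
    ∑ j ∈ Icc (max i (s k)) N, w j * gain N G s k j
      ≤ ∑ j ∈ Icc (max i (s (k + 1))) N, w j * gain N G s (k + 1) j := by
  have hnonneg : ∀ j ∈ Icc (max i (s (k + 1))) N, 0 ≤ w j * gain N G s (k + 1) j := by
    intro j hj
    rw [Finset.mem_Icc, max_le_iff] at hj
    have hs1 := (h.isLeast (k + 1) (Nat.le_add_left 1 k) hkm).1.1
    exact mul_nonneg (hw j (hs1.trans hj.1.2))
      (h.gain_nonneg (Nat.le_add_left 1 k) hkm hj.1.2 hj.2)
  rcases k.eq_zero_or_pos with rfl | hk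
  · simpa only [gain, mul_zero, sum_const_zero] using sum_nonneg hnonneg
  refine le_trans (sum_le_sum fun j hj => ?_) <| sum_le_sum_of_subset_of_nonneg
    (Icc_subset_Icc_left (max_le_max le_rfl (h.apply_succ_le hk hkm))) fun j hj _ => hnonneg j hj
  rw [Finset.mem_Icc, max_le_iff] at hj
  have hj1 : 1 ≤ j := (h.isLeast k hk hkm.le).1.1.trans hj.1.2
  exact mul_le_mul_of_nonneg_left (h.le_next k hk hkm j hj1 hj.2) (hw j hj1)

lemma gain_le_gain_succ (h : IsCriticalSequence N m G s) (hm : 1 ≤ m) (i : ℕ) :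
    gain N G s m i ≤ gain N G s (m + 1) i := by
  obtain ⟨k, rfl⟩ := Nat.exists_eq_add_of_le' hm
  rw [gain_succ, gain_succ]
  exact add_le_add_right (h.sum_gain_le_sum_gain_succ k.lt_succ_self (i + 1)
    fun j hj => one_div_nonneg.2 (sub_nonneg.2 (Nat.one_le_cast.2 hj))) (G i)

lemma succ (h : IsCriticalSequence N m G s) (hK : 1 ≤ K) (hKN : K ≤ N)
    (hmono : ∀ i, 1 ≤ i → i + 1 < K → gain N G s (m + 1) i ≤ gain N G s (m + 1) (i + 1))
    (hnonneg : ∀ i, K ≤ i → i ≤ N → 0 ≤ gain N G s (m + 1) i)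
    (hs : s (m + 1) = sInf {i : ℕ | 1 ≤ i ∧ i ≤ N ∧ 0 ≤ gain N G s (m + 1) i}) :
    IsCriticalSequence N (m + 1) G s := by
  have hleast : IsLeast {i : ℕ | 1 ≤ i ∧ i ≤ N ∧ 0 ≤ gain N G s (m + 1) i} (s (m + 1)) :=
    hs ▸ ⟨Nat.sInf_mem ⟨K, hK, hKN, hnonneg K le_rfl hKN⟩, fun i hi => Nat.sInf_le hi⟩
  have hcases : ∀ k ≤ m + 1, k ≤ m ∨ k = m + 1 := fun k hk => Nat.le_succ_iff.1 hk
  refine ⟨fun k hk hkm i hi hiN h0 => ?_, fun k hk hkm i hi hiN => ?_, fun k hk hkm i hi his => ?_,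
    fun k hk hkm => ?_⟩
  · rcases hcases k hkm with hkm | rfl
    · exact h.nonneg_succ k hk hkm i hi hiN h0
    · rcases lt_or_ge (i + 1) K with hiK | hiK
      exacts [h0.trans (hmono i hi hiK), hnonneg _ hiK hiN]
  · rcases (Nat.lt_succ_iff.1 hkm).lt_or_eq with hkm | rfl
    exacts [h.le_next k hk hkm i hi hiN, h.gain_le_gain_succ hk i]
  · rcases hcases k hkm with hkm | rfl
    · exact h.le_succ k hk hkm i hi his
    · rcases lt_or_ge (i + 1) K with hiK | hiK
      · exact hmono i hi hiK
      · have hiN : i + 1 ≤ N := Nat.succ_le_of_lt his |>.trans hleast.1.2.1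
        have hneg : gain N G s (m + 1) i < 0 := not_le.1 fun h0 =>
          his.not_ge (hleast.2 ⟨hi, (Nat.le_succ i).trans hiN, h0⟩)
        exact hneg.le.trans (hnonneg _ hiK hiN)
  · rcases hcases k hkm with hkm | rfl
    exacts [h.isLeast k hk hkm, hleast]

end IsCriticalSequence

theorem isCriticalSequence_criticalNumber (hK : 1 ≤ K) (hKN : K ≤ N)
    (hmono : MonotoneOn G (Set.Icc 1 K)) (hnonneg : ∀ i, K ≤ i → i ≤ N → 0 ≤ G i) (m : ℕ) :
    IsCriticalSequence N m G (criticalNumber N G) := by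
  have hstep : ∀ i, 1 ≤ i → i + 1 ≤ K → G i ≤ G (i + 1) := fun i hi hiK =>
    hmono ⟨hi, (Nat.le_succ i).trans hiK⟩ ⟨Nat.le_add_left 1 i, hiK⟩ (Nat.le_succ i)
  induction m with
  | zero => constructor <;> intros <;> omega
  | succ m ih =>
    have hs := criticalNumber_eq_sInf N G (m + 1)
    rcases m.eq_zero_or_pos with rfl | hm
    · exact ih.succ hK hKN (fun i hi hiK => hstep i hi hiK.le) hnonneg hs
    obtain ⟨hs1, hsN, -⟩ := (ih.isLeast m hm le_rfl).1
    have hsK := ih.apply_le hm le_rfl hK hKN (hnonneg K le_rfl hKN)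
    refine ih.succ hs1 hsN (fun i hi his => ?_) (fun i hi hiN => ?_) hs
    · rw [gain_succ, gain_succ, max_eq_right his.le, max_eq_right his]
      exact add_le_add_left (hstep i hi (his.le.trans hsK)) _
    · exact (ih.gain_nonneg hm le_rfl hi hiN).trans (ih.gain_le_gain_succ hm i)

end CriticalNumbers

section ThresholdValue

variable {m K N k i : ℕ} {u G : ℕ → ℝ} {s : ℕ → ℕ}

/-- `u i` is the mean payoff of a candidate chosen at time `i`: it increases up to time `K` and
decreases from `K` to `N`, the last time at which it is nonnegative. -/
structure IsUnimodalPayoff (n K N : ℕ) (u : ℕ → ℝ) : Prop where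
  one_le_peak : 1 ≤ K
  peak_le_last : K ≤ N
  last_le : N ≤ n
  monotoneOn : MonotoneOn u (Set.Icc 1 K)
  antitoneOn : AntitoneOn u (Set.Icc K N)
  last_nonneg : 0 ≤ u N
  nonpos : ∀ i, N < i → i ≤ n → u i ≤ 0

/-- `i * G i` is the advantage, with one choice left, of choosing a candidate at time `i` over
waiting for the next candidate, if no choice is made after time `N`. The recursion stated here
determines `G` on `{1, …, N}`. -/
structure IsOneChoiceGain (N : ℕ) (u G : ℕ → ℝ) : Prop where
  last : N * G N = u N
  step : ∀ i, 1 ≤ i → i < N → i * (G (i + 1) - G i) = u (i + 1) - u i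

namespace IsOneChoiceGain

lemma monotoneOn (hG : IsOneChoiceGain N u G) (hu : IsUnimodalPayoff n K N u) :
    MonotoneOn G (Set.Icc 1 K) := by
  refine monotoneOn_of_le_add_one Set.ordConnected_Icc fun i _ hi hi' => ?_
  have hstep := hG.step i hi.1 (Nat.lt_of_succ_le (hi'.2.trans hu.peak_le_last))
  have hle := hu.monotoneOn hi hi' (Nat.le_succ i)
  have hpos : (0 : ℝ) < i := Nat.cast_pos.2 hi.1
  exact sub_nonneg.1 (nonneg_of_mul_nonneg_right (hstep ▸ sub_nonneg.2 hle) hpos)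

lemma nonneg (hG : IsOneChoiceGain N u G) (hu : IsUnimodalPayoff n K N u) (hKi : K ≤ i)
    (hiN : i ≤ N) : 0 ≤ G i := by
  have hpos : ∀ j, K ≤ j → (0 : ℝ) < j := fun j hj => Nat.cast_pos.2 (hu.one_le_peak.trans hj)
  induction hiN using Nat.decreasingInduction with
  | self => exact nonneg_of_mul_nonneg_right (hG.last ▸ hu.last_nonneg) (hpos N hKi)
  | of_succ i hlt ih =>
    have hstep := hG.step i (hu.one_le_peak.trans hKi) hlt
    have hle := hu.antitoneOn ⟨hKi, hlt.le⟩ ⟨hKi.trans (Nat.le_succ i), hlt⟩ (Nat.le_succ i)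
    have hnext := ih (hKi.trans (Nat.le_succ i))
    refine hnext.trans (sub_nonpos.1 ?_)
    exact nonpos_of_mul_nonpos_right (hstep ▸ sub_nonpos.2 hle) (hpos i hKi)

lemma isCriticalSequence (hG : IsOneChoiceGain N u G) (hu : IsUnimodalPayoff n K N u) (m : ℕ) :
    IsCriticalSequence N m G (criticalNumber N G) :=
  isCriticalSequence_criticalNumber hu.one_le_peak hu.peak_le_last (hG.monotoneOn hu)
    (fun _ => hG.nonneg hu) m

end IsOneChoiceGain

/-- The expected payoff from the times `i, …, n` of the threshold strategy with `k` choices left.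
A candidate appears at time `j` with probability `1 / j`, and choosing it is worth
`j * G^{(k)}_j` more than passing it over. -/
noncomputable def thresholdValue (N : ℕ) (G : ℕ → ℝ) (s : ℕ → ℕ) (k i : ℕ) : ℝ :=
  ∑ j ∈ Icc (max i (s k)) N, gain N G s k j

lemma thresholdValue_zero (i : ℕ) : thresholdValue N G s 0 i = 0 := by
  simp only [thresholdValue, gain, sum_const_zero]

lemma thresholdValue_of_lt (hi : N < i) : thresholdValue N G s k i = 0 := by
  rw [thresholdValue, Icc_eq_empty (lt_max_of_lt_left hi).not_ge, sum_empty]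

lemma thresholdValue_of_le (hi : i ≤ s k) :
    thresholdValue N G s k i = thresholdValue N G s k (s k) := by
  rw [thresholdValue, thresholdValue, max_eq_right hi, max_self]

lemma sum_Icc_max_eq_add {t : ℕ} (hi : i ≤ N) (f : ℕ → ℝ) :
    ∑ j ∈ Icc (max i t) N, f j
      = (if t ≤ i then f i else 0) + ∑ j ∈ Icc (max (i + 1) t) N, f j := by
  split_ifs with h
  · rw [max_eq_left h, max_eq_left (Nat.le_add_right_of_le h), ← insert_Icc_add_one_left_eq_Icc hi,
      sum_insert (by simp)]
  · rw [max_eq_right (not_le.1 h).le, max_eq_right (not_le.1 h), zero_add]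

lemma thresholdValue_eq_ite_add (hi : i ≤ N) :
    thresholdValue N G s k i
      = (if s k ≤ i then gain N G s k i else 0) + thresholdValue N G s k (i + 1) :=
  sum_Icc_max_eq_add hi _

lemma mul_gain_succ_eq (hG : IsOneChoiceGain N u G) (k : ℕ) (hi : 1 ≤ i) (hiN : i < N) :
    i * gain N G s (k + 1) i = i * gain N G s (k + 1) (i + 1) + (u i - u (i + 1))
      + (thresholdValue N G s k (i + 1) - thresholdValue N G s k (i + 1 + 1)) := by
  have hstep := hG.step i hi hiN
  have hne : (i : ℝ) ≠ 0 := Nat.cast_ne_zero.2 (Nat.pos_iff_ne_zero.1 hi)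
  rw [thresholdValue_eq_ite_add (show i + 1 ≤ N from hiN), gain_succ, gain_succ,
    sum_Icc_max_eq_add (show i + 1 ≤ N from hiN), Nat.cast_succ, add_sub_cancel_right]
  split_ifs
  · field_simp
    linarith
  · linarith

/-- What is gained by choosing a candidate at time `i`, with `k + 1` choices left, over passing it
over, if the threshold strategy is used afterwards. -/
noncomputable def advantage (u : ℕ → ℝ) (N : ℕ) (G : ℕ → ℝ) (s : ℕ → ℕ) (k i : ℕ) : ℝ :=
  u i + thresholdValue N G s k (i + 1) - thresholdValue N G s (k + 1) (i + 1)

lemma advantage_eq_mul_gain (hG : IsOneChoiceGain N u G) (hi : 1 ≤ i) (hiN : i ≤ N)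
    (his : s (k + 1) ≤ i + 1) : advantage u N G s k i = i * gain N G s (k + 1) i := by
  induction hiN using Nat.decreasingInduction with
  | self =>
    rw [advantage, thresholdValue_of_lt (Nat.lt_succ_self N),
      thresholdValue_of_lt (Nat.lt_succ_self N), gain_succ,
      Icc_eq_empty (lt_max_of_lt_left (Nat.lt_succ_self N)).not_ge, sum_empty, add_zero,
      add_zero, sub_zero, hG.last]
  | of_succ i hlt ih =>
    have hnext := ih (Nat.le_add_left 1 i) (his.trans (Nat.le_succ _))
    rw [advantage, Nat.cast_succ] at hnext
    rw [mul_gain_succ_eq hG k hi hlt, advantage,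
      thresholdValue_eq_ite_add (k := k + 1) (show i + 1 ≤ N from hlt), if_pos his]
    linarith

lemma advantage_nonneg (hG : IsOneChoiceGain N u G) (hs : IsCriticalSequence N m G s)
    (hk : k < m) (his : s (k + 1) ≤ i) (hiN : i ≤ N) : 0 ≤ advantage u N G s k i := by
  have hs1 := (hs.isLeast (k + 1) (Nat.le_add_left 1 k) hk).1.1
  rw [advantage_eq_mul_gain hG (hs1.trans his) hiN (his.trans (Nat.le_succ i))]
  exact mul_nonneg (Nat.cast_nonneg i) (hs.gain_nonneg (Nat.le_add_left 1 k) hk his hiN)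

lemma IsCriticalSequence.thresholdValue_of_le_apply_succ (hs : IsCriticalSequence N m G s)
    (hk : k < m) (hi : i ≤ s (k + 1)) :
    thresholdValue N G s k i = thresholdValue N G s k (s (k + 1)) := by
  rcases k.eq_zero_or_pos with rfl | hk1
  · rw [thresholdValue_zero, thresholdValue_zero]
  · have hsk := hs.apply_succ_le hk1 hk
    rw [thresholdValue_of_le (hi.trans hsk), thresholdValue_of_le hsk]

lemma advantage_nonpos_of_lt_apply_succ (hu : IsUnimodalPayoff n K N u)
    (hG : IsOneChoiceGain N u G) (hs : IsCriticalSequence N m G s) (hk : k < m) (hi : 1 ≤ i)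
    (his : i < s (k + 1)) : advantage u N G s k i ≤ 0 := by
  have hk1 : 1 ≤ k + 1 := Nat.le_add_left 1 k
  have hsK : s (k + 1) ≤ K := hs.apply_le hk1 hk hu.one_le_peak hu.peak_le_last
    (hG.nonneg hu le_rfl hu.peak_le_last)
  obtain ⟨t, ht⟩ : ∃ t, s (k + 1) = t + 1 := ⟨_, (Nat.succ_pred_eq_of_pos (by omega)).symm⟩
  have hit : i ≤ t := Nat.lt_succ_iff.1 (his.trans_eq ht)
  have ht_neg : advantage u N G s k t ≤ 0 := by
    rw [advantage_eq_mul_gain hG (hi.trans hit) (by have := hu.peak_le_last; omega) ht.le]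
    exact mul_nonpos_of_nonneg_of_nonpos (Nat.cast_nonneg t)
      (hs.gain_neg hk1 hk (hi.trans hit) (ht ▸ t.lt_succ_self)).le
  have hut : u i ≤ u t := hu.monotoneOn ⟨hi, by omega⟩ ⟨hi.trans hit, by omega⟩ hit
  rw [advantage, ← ht, thresholdValue_of_le le_rfl] at ht_neg
  rw [advantage, hs.thresholdValue_of_le_apply_succ hk his, thresholdValue_of_le his]
  linarith

lemma advantage_nonpos (hu : IsUnimodalPayoff n K N u) (hG : IsOneChoiceGain N u G)
    (hs : IsCriticalSequence N m G s) (hk : k < m) (hi : 1 ≤ i) (hin : i ≤ n)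
    (hpass : ¬ (s (k + 1) ≤ i ∧ i ≤ N)) : advantage u N G s k i ≤ 0 := by
  by_cases his : s (k + 1) ≤ i
  · have hiN : N < i := not_le.1 fun h => hpass ⟨his, h⟩
    rw [advantage, thresholdValue_of_lt (hiN.trans i.lt_succ_self),
      thresholdValue_of_lt (hiN.trans i.lt_succ_self), add_zero, sub_zero]
    exact hu.nonpos i hiN hin
  · exact advantage_nonpos_of_lt_apply_succ hu hG hs hk hi (not_le.1 his)

lemma nonneg_apply_criticalSequence (hG : IsOneChoiceGain N u G)
    (hs : IsCriticalSequence N m G s) (hk : 1 ≤ k) (hkm : k ≤ m) : 0 ≤ u (s k) := by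
  obtain ⟨k, rfl⟩ := Nat.exists_eq_add_of_le' hk
  have hadv := advantage_nonneg hG hs hkm le_rfl (hs.isLeast (k + 1) hk hkm).1.2.1
  have hle := hs.sum_gain_le_sum_gain_succ hkm (s (k + 1) + 1) (w := 1) fun _ _ => zero_le_one
  simp only [Pi.one_apply, one_mul] at hle
  rw [advantage, thresholdValue, thresholdValue] at hadv
  linarith

end ThresholdValue

section StateValue

variable {m K N k i : ℕ} {u G : ℕ → ℝ} {s : ℕ → ℕ} {σ : Equiv.Perm (Fin n)}

open Classical in
/-- The maximal conditional expected payoff of `k` choices at the times `i, …, n`, given the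
observations up to time `i`, written as the Bellman equation: a candidate at time `i` is either
chosen or passed over. -/
noncomputable def stateValue (u : ℕ → ℝ) (N : ℕ) (G : ℕ → ℝ) (s : ℕ → ℕ) :
    ℕ → ℕ → Equiv.Perm (Fin n) → ℝ
  | 0, _, _ => 0
  | k + 1, i, σ =>
    if IsCandidate σ i then
      max (u i + thresholdValue N G s k (i + 1)) (thresholdValue N G s (k + 1) (i + 1))
    else thresholdValue N G s (k + 1) (i + 1)

lemma pass_le_stateValue (k i : ℕ) (σ : Equiv.Perm (Fin n)) :
    thresholdValue N G s k (i + 1) ≤ stateValue u N G s k i σ := by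
  cases k with
  | zero => rw [thresholdValue_zero, stateValue]
  | succ k =>
    rw [stateValue]
    split_ifs
    exacts [le_max_right _ _, le_rfl]

lemma select_le_stateValue (k : ℕ) (h : IsCandidate σ i) :
    u i + thresholdValue N G s k (i + 1) ≤ stateValue u N G s (k + 1) i σ := by
  rw [stateValue, if_pos h]
  exact le_max_left _ _

lemma stateValue_of_select (hG : IsOneChoiceGain N u G) (hs : IsCriticalSequence N m G s)
    (hk : k < m) (h : IsCandidate σ i) (his : s (k + 1) ≤ i) (hiN : i ≤ N) :
    stateValue u N G s (k + 1) i σ = u i + thresholdValue N G s k (i + 1) := by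
  rw [stateValue, if_pos h, max_eq_left]
  exact sub_nonneg.1 (advantage_nonneg hG hs hk his hiN)

lemma stateValue_of_pass (hu : IsUnimodalPayoff n K N u) (hG : IsOneChoiceGain N u G)
    (hs : IsCriticalSequence N m G s) (hk : k < m) (hi : 1 ≤ i) (hin : i ≤ n)
    (h : ¬ (IsCandidate σ i ∧ s (k + 1) ≤ i ∧ i ≤ N)) :
    stateValue u N G s (k + 1) i σ = thresholdValue N G s (k + 1) (i + 1) := by
  rw [stateValue]
  split_ifs with hσ
  · exact max_eq_right <| sub_nonpos.1 <|
      advantage_nonpos hu hG hs hk hi hin fun hiN => h ⟨hσ, hiN⟩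
  · rfl

lemma stateValue_end (hN : N ≤ n) (k : ℕ) (σ : Equiv.Perm (Fin n)) :
    stateValue u N G s k (n + 1) σ = 0 := by
  cases k with
  | zero => rfl
  | succ k => rw [stateValue, if_neg fun hσ => n.lt_succ_self.not_ge hσ.mem_Icc.2,
      thresholdValue_of_lt (Nat.lt_add_right 1 (Nat.lt_succ_of_le hN))]

lemma thresholdValue_eq_add_div (hu : IsUnimodalPayoff n K N u) (hG : IsOneChoiceGain N u G)
    (hs : IsCriticalSequence N m G s) (hk : k < m) (hi : 1 ≤ i) (hin : i ≤ n) :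
    thresholdValue N G s (k + 1) i = thresholdValue N G s (k + 1) (i + 1)
      + (max (u i + thresholdValue N G s k (i + 1)) (thresholdValue N G s (k + 1) (i + 1))
        - thresholdValue N G s (k + 1) (i + 1)) / i := by
  by_cases hchoose : s (k + 1) ≤ i ∧ i ≤ N
  · obtain ⟨his, hiN⟩ := hchoose
    have hne : (i : ℝ) ≠ 0 := Nat.cast_ne_zero.2 (Nat.pos_iff_ne_zero.1 hi)
    rw [max_eq_left (sub_nonneg.1 (advantage_nonneg hG hs hk his hiN)), ← advantage,
      advantage_eq_mul_gain hG hi hiN (his.trans (Nat.le_succ i)), mul_div_cancel_left₀ _ hne,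
      thresholdValue_eq_ite_add hiN, if_pos his, add_comm]
  · rw [max_eq_right (sub_nonpos.1 (advantage_nonpos hu hG hs hk hi hin hchoose)), sub_self,
      zero_div, add_zero]
    rcases le_or_gt i N with hiN | hiN
    · rw [thresholdValue_eq_ite_add hiN, if_neg fun his => hchoose ⟨his, hiN⟩, zero_add]
    · rw [thresholdValue_of_lt hiN, thresholdValue_of_lt (hiN.trans i.lt_succ_self)]

lemma mean_stateValue (hu : IsUnimodalPayoff n K N u) (hG : IsOneChoiceGain N u G)
    (hs : IsCriticalSequence N m G s) (hk : k ≤ m) (hi : i ≤ n) (σ₀ : Equiv.Perm (Fin n)) :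
    mean (sameHistory i σ₀) (stateValue u N G s k (i + 1)) = thresholdValue N G s k (i + 1) := by
  have hclass := sameHistory_nonempty i σ₀
  rcases hi.lt_or_eq with hi | rfl
  · cases k with
    | zero => rw [thresholdValue_zero]; exact mean_const hclass 0
    | succ k =>
      change mean _ (fun σ => stateValue u N G s (k + 1) (i + 1) σ) = _
      simp only [stateValue]
      rw [mean_ite_isCandidate hi, ← Nat.cast_succ,
        ← thresholdValue_eq_add_div hu hG hs hk (Nat.le_add_left 1 i) hi]
  · rw [thresholdValue_of_lt (Nat.lt_succ_of_le hu.last_le)]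
    exact mean_eq_of_forall hclass fun σ _ => stateValue_end hu.last_le k σ

end StateValue

section UpperBound

variable {m K N k i : ℕ} {u G : ℕ → ℝ} {s : ℕ → ℕ}
  {w : Equiv.Perm (Fin n) → WithTop ℕ → ℝ} {S S' : Finset (Equiv.Perm (Fin n))}

/-- `w σ x` is the payoff of a choice made at the random time `x`, where `⊤` means that the choice
is not made; its conditional mean at a candidate depends on the time only and equals `u`. -/
structure HasMeanPayoff (w : Equiv.Perm (Fin n) → WithTop ℕ → ℝ) (u : ℕ → ℝ) : Prop where
  top : ∀ σ, w σ ⊤ = 0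
  mean_coe : ∀ i σ₀, 1 ≤ i → i ≤ n → IsCandidate σ₀ i →
    mean (sameHistory i σ₀) (fun σ => w σ (i : WithTop ℕ)) = u i

/-- The requirements of `IsAdmissible` on the rankings in `S` only. Unlike `IsAdmissible` they are
inherited by the later choices once the observations show when the first choice is made. -/
structure IsAdmissibleOn (S : Finset (Equiv.Perm (Fin n))) (k i : ℕ)
    (τ : Fin k → Equiv.Perm (Fin n) → WithTop ℕ) : Prop where
  adapted : ∀ l, ∀ σ ∈ S, ∀ σ' ∈ S, ∀ j : ℕ, history j σ = history j σ' →
    τ l σ = (j : WithTop ℕ) → τ l σ' = (j : WithTop ℕ)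
  candidate : ∀ l, ∀ σ ∈ S, ∀ j : ℕ, τ l σ = (j : WithTop ℕ) → IsCandidate σ j
  start : ∀ l, ∀ σ ∈ S, (i : WithTop ℕ) ≤ τ l σ
  increasing : ∀ l l', ∀ σ ∈ S, l < l' → τ l σ < τ l' σ ∨ (τ l σ = ⊤ ∧ τ l' σ = ⊤)

lemma coe_add_one_le_of_lt {x : WithTop ℕ} (h : (i : WithTop ℕ) < x) :
    ((i + 1 : ℕ) : WithTop ℕ) ≤ x := by
  cases x with
  | top => exact le_top
  | coe j => exact WithTop.coe_le_coe.2 (WithTop.coe_lt_coe.1 h)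

lemma measurableSet_rankFiltration_iff {j : ℕ} {A : Set (Equiv.Perm (Fin n))} :
    @MeasurableSet _ (rankFiltration n j) A
      ↔ ∀ σ σ', history j σ = history j σ' → σ ∈ A → σ' ∈ A := by
  refine ⟨?_, fun h => ⟨history j '' A, trivial, Set.Subset.antisymm ?_ ?_⟩⟩
  · rintro ⟨B, -, rfl⟩ σ σ' h hσ
    exact Set.mem_preimage.2 (h ▸ hσ)
  · rintro σ ⟨ρ, hρ, hσ⟩
    exact h ρ σ hσ hρ
  · exact Set.subset_preimage_image _ _

lemma IsAdmissible.isAdmissibleOn {τ : Fin k → Equiv.Perm (Fin n) → WithTop ℕ}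
    (h : IsAdmissible k i τ) (S : Finset (Equiv.Perm (Fin n))) : IsAdmissibleOn S k i τ where
  adapted l σ _ σ' _ j hhist hj :=
    measurableSet_rankFiltration_iff.1 ((h.stopping l).measurableSet_eq j) σ σ' hhist hj
  candidate l σ _ := h.candidate l σ
  start l σ _ := h.start l σ
  increasing l l' σ _ := h.increasing l l' σ

namespace IsAdmissibleOn

lemma mono {τ : Fin k → Equiv.Perm (Fin n) → WithTop ℕ} (h : IsAdmissibleOn S k i τ)
    (hS : S' ⊆ S) : IsAdmissibleOn S' k i τ where
  adapted l σ hσ σ' hσ' := h.adapted l σ (hS hσ) σ' (hS hσ')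
  candidate l σ hσ := h.candidate l σ (hS hσ)
  start l σ hσ := h.start l σ (hS hσ)
  increasing l l' σ hσ := h.increasing l l' σ (hS hσ)

variable {τ : Fin (k + 1) → Equiv.Perm (Fin n) → WithTop ℕ}

lemma add_one_le_succ (h : IsAdmissibleOn S (k + 1) i τ) {σ : Equiv.Perm (Fin n)} (hσ : σ ∈ S)
    (l : Fin k) : ((i + 1 : ℕ) : WithTop ℕ) ≤ τ l.succ σ := by
  rcases h.increasing 0 l.succ σ hσ l.succ_pos with hlt | ⟨-, htop⟩
  · exact coe_add_one_le_of_lt ((h.start 0 σ hσ).trans_lt hlt)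
  · exact htop ▸ le_top

lemma tail (h : IsAdmissibleOn S (k + 1) i τ) :
    IsAdmissibleOn S k (i + 1) fun l => τ l.succ where
  adapted l := h.adapted l.succ
  candidate l := h.candidate l.succ
  start l _ hσ := h.add_one_le_succ hσ l
  increasing l l' σ hσ hl := h.increasing l.succ l'.succ σ hσ (Fin.succ_lt_succ_iff.2 hl)

lemma of_ne_start (h : IsAdmissibleOn S (k + 1) i τ)
    (hne : ∀ σ ∈ S, τ 0 σ ≠ (i : WithTop ℕ)) : IsAdmissibleOn S (k + 1) (i + 1) τ where
  adapted := h.adapted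
  candidate := h.candidate
  start l σ hσ := by
    cases l using Fin.cases with
    | zero => exact coe_add_one_le_of_lt ((h.start 0 σ hσ).lt_of_ne (hne σ hσ).symm)
    | succ l => exact h.add_one_le_succ hσ l
  increasing := h.increasing

lemma sum_payoff_eq_zero {τ : Fin k → Equiv.Perm (Fin n) → WithTop ℕ}
    (h : IsAdmissibleOn S k (n + 1) τ) (hw : HasMeanPayoff w u) {σ : Equiv.Perm (Fin n)}
    (hσ : σ ∈ S) : ∑ l, w σ (τ l σ) = 0 := by
  refine sum_eq_zero fun l _ => ?_
  cases hτ : τ l σ with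
  | top => exact hw.top σ
  | coe j =>
    have hstart := h.start l σ hσ
    rw [hτ] at hstart
    exact absurd (h.candidate l σ hσ j hτ).mem_Icc.2
      (not_le.2 (Nat.lt_of_succ_le (Nat.cast_le.1 hstart)))

end IsAdmissibleOn

lemma mean_sum_payoff_of_select {τ : Fin (k + 1) → Equiv.Perm (Fin n) → WithTop ℕ}
    {σ₀ : Equiv.Perm (Fin n)} (hw : HasMeanPayoff w u) (hi : 1 ≤ i) (hin : i ≤ n)
    (hσ₀ : IsCandidate σ₀ i) (hτ : ∀ σ ∈ sameHistory i σ₀, τ 0 σ = (i : WithTop ℕ)) :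
    mean (sameHistory i σ₀) (fun σ => ∑ l, w σ (τ l σ))
      = u i + mean (sameHistory i σ₀) (fun σ => ∑ l : Fin k, w σ (τ l.succ σ)) := by
  rw [← hw.mean_coe i σ₀ hi hin hσ₀, ← mean_add]
  exact mean_congr fun σ hσ => by rw [Fin.sum_univ_succ, hτ σ hσ]

theorem mean_sum_payoff_le_stateValue (hu : IsUnimodalPayoff n K N u)
    (hG : IsOneChoiceGain N u G) (hs : IsCriticalSequence N m G s) (hw : HasMeanPayoff w u)
    (hk : k ≤ m) (hi : 1 ≤ i) (hin : i ≤ n + 1) (σ₀ : Equiv.Perm (Fin n))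
    {τ : Fin k → Equiv.Perm (Fin n) → WithTop ℕ} (hτ : IsAdmissibleOn (sameHistory i σ₀) k i τ) :
    mean (sameHistory i σ₀) (fun σ => ∑ l, w σ (τ l σ)) ≤ stateValue u N G s k i σ₀ := by
  have hself := mem_sameHistory.2 (rfl : history i σ₀ = history i σ₀)
  induction hin using Nat.decreasingInduction generalizing k σ₀ with
  | self =>
    rw [mean_eq_of_forall ⟨σ₀, hself⟩ fun σ => hτ.sum_payoff_eq_zero hw,
      stateValue_end hu.last_le]
  | of_succ i hlt ih =>
    have hin : i ≤ n := Nat.lt_succ_iff.1 hlt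
    have hlater : ∀ k ≤ m, ∀ τ : Fin k → Equiv.Perm (Fin n) → WithTop ℕ,
        IsAdmissibleOn (sameHistory i σ₀) k (i + 1) τ →
        mean (sameHistory i σ₀) (fun σ => ∑ l, w σ (τ l σ)) ≤ thresholdValue N G s k (i + 1) := by
      intro k hk τ hτ
      have hsub := fun σ => sameHistory_subset (σ := σ) (σ₀ := σ₀) (Nat.le_succ i)
      rw [← mean_stateValue hu hG hs hk hin σ₀, ← mean_mean_sameHistory hsub]
      exact mean_mono fun σ hσ =>
        ih hk (Nat.le_add_left 1 i) σ (hτ.mono (hsub σ hσ)) (mem_sameHistory.2 rfl)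
    cases k with
    | zero => exact (hlater 0 hk τ ⟨fun l => l.elim0, fun l => l.elim0, fun l => l.elim0,
        fun l => l.elim0⟩).trans (pass_le_stateValue 0 i σ₀)
    | succ k =>
      by_cases h0 : τ 0 σ₀ = (i : WithTop ℕ)
      · have hσ₀ := hτ.candidate 0 σ₀ hself i h0
        have hselect : ∀ σ ∈ sameHistory i σ₀, τ 0 σ = (i : WithTop ℕ) := fun σ hσ =>
          hτ.adapted 0 σ₀ hself σ hσ i (mem_sameHistory.1 hσ).symm h0
        rw [mean_sum_payoff_of_select hw hi hin hσ₀ hselect]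
        exact (add_le_add_right (hlater k (Nat.le_of_succ_le hk) _ hτ.tail) _).trans
          (select_le_stateValue k hσ₀)
      · have hne : ∀ σ ∈ sameHistory i σ₀, τ 0 σ ≠ (i : WithTop ℕ) := fun σ hσ hσi =>
          h0 (hτ.adapted 0 σ hσ σ₀ hself i (mem_sameHistory.1 hσ) hσi)
        exact (hlater (k + 1) hk τ (hτ.of_ne_start hne)).trans (pass_le_stateValue (k + 1) i σ₀)

end UpperBound

section Threshold

variable {m K N k i j b t : ℕ} {u G : ℕ → ℝ} {s : ℕ → ℕ} {σ : Equiv.Perm (Fin n)}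
  {w : Equiv.Perm (Fin n) → WithTop ℕ → ℝ}

lemma firstCandidate_eq_coe {lo hi : ℕ}
    (h : IsLeast {t | lo ≤ t ∧ t ≤ hi ∧ IsCandidate σ t} j) :
    firstCandidate σ lo hi = (j : WithTop ℕ) := by
  refine IsLeast.csInf_eq ⟨⟨j, rfl, h.1⟩, ?_⟩
  rintro _ ⟨t, rfl, ht⟩
  exact WithTop.coe_le_coe.2 (h.2 ht)

lemma firstCandidate_eq_top {lo hi : ℕ} (h : ∀ t, ¬ (lo ≤ t ∧ t ≤ hi ∧ IsCandidate σ t)) :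
    firstCandidate σ lo hi = ⊤ := by
  simp only [firstCandidate, h, and_false, exists_false, Set.ofPred_false, WithTop.sInf_empty]

lemma thresholdTimes_eq_cons
    (h : IsLeast {t | max i (s (k + 1)) ≤ t ∧ t ≤ b ∧ IsCandidate σ t} j) :
    thresholdTimes s b σ (k + 1) i
      = Fin.cons (j : WithTop ℕ) (thresholdTimes s b σ k (j + 1)) := by
  rw [thresholdTimes, firstCandidate_eq_coe h]
  rfl

lemma thresholdTimes_eq_top_or_cons (s : ℕ → ℕ) (b : ℕ) (σ : Equiv.Perm (Fin n)) (k i : ℕ) :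
    thresholdTimes s b σ (k + 1) i = (fun _ => ⊤) ∨
      ∃ j, IsLeast {t | max i (s (k + 1)) ≤ t ∧ t ≤ b ∧ IsCandidate σ t} j ∧
        thresholdTimes s b σ (k + 1) i
          = Fin.cons (j : WithTop ℕ) (thresholdTimes s b σ k (j + 1)) := by
  by_cases h : ∃ t, max i (s (k + 1)) ≤ t ∧ t ≤ b ∧ IsCandidate σ t
  · have hleast := (⟨Nat.sInf_mem h, fun t ht => Nat.sInf_le ht⟩ : IsLeast {t | _} _)
    exact Or.inr ⟨_, hleast, thresholdTimes_eq_cons hleast⟩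
  · left
    rw [thresholdTimes, firstCandidate_eq_top (not_exists.1 h)]
    exact Fin.cons_self_tail (fun _ => ⊤)

lemma le_thresholdTimes (σ : Equiv.Perm (Fin n)) (k i : ℕ) (l : Fin k) :
    (i : WithTop ℕ) ≤ thresholdTimes s b σ k i l := by
  induction k generalizing i with
  | zero => exact l.elim0
  | succ k ih =>
    rcases thresholdTimes_eq_top_or_cons s b σ k i with h | ⟨j, hj, h⟩
    · exact h ▸ le_top
    · have hij : i ≤ j := le_of_max_le_left hj.1.1
      rw [h]
      cases l using Fin.cases with
      | zero => exact WithTop.coe_le_coe.2 hij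
      | succ l => exact (WithTop.coe_le_coe.2 (Nat.le_succ_of_le hij)).trans (ih (j + 1) l)

lemma isCandidate_thresholdTimes {l : Fin k} (ht : thresholdTimes s b σ k i l = (t : WithTop ℕ)) :
    IsCandidate σ t := by
  induction k generalizing i with
  | zero => exact l.elim0
  | succ k ih =>
    rcases thresholdTimes_eq_top_or_cons s b σ k i with h | ⟨j, hj, h⟩ <;> rw [h] at ht
    · exact absurd ht.symm (WithTop.coe_ne_top)
    · cases l using Fin.cases with
      | zero =>
        obtain rfl : j = t := WithTop.coe_injective ht
        exact hj.1.2.2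
      | succ l => exact ih ht

lemma thresholdTimes_lt_or_eq_top {l l' : Fin k} (hl : l < l') :
    thresholdTimes s b σ k i l < thresholdTimes s b σ k i l' ∨
      (thresholdTimes s b σ k i l = ⊤ ∧ thresholdTimes s b σ k i l' = ⊤) := by
  induction k generalizing i with
  | zero => exact l.elim0
  | succ k ih =>
    rcases thresholdTimes_eq_top_or_cons s b σ k i with h | ⟨j, -, h⟩ <;> rw [h]
    · exact Or.inr ⟨rfl, rfl⟩
    · cases l' using Fin.cases with
      | zero => exact absurd hl (Fin.not_lt_zero l)
      | succ l' =>
        cases l using Fin.cases with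
        | zero => exact Or.inl <|
            (WithTop.coe_lt_coe.2 j.lt_succ_self).trans_le (le_thresholdTimes σ k (j + 1) l')
        | succ l => exact ih (Fin.succ_lt_succ_iff.1 hl)

lemma isLeast_isCandidate_congr {lo hi : ℕ} {σ' : Equiv.Perm (Fin n)}
    (hσ : history j σ = history j σ') (h : IsLeast {t | lo ≤ t ∧ t ≤ hi ∧ IsCandidate σ t} j) :
    IsLeast {t | lo ≤ t ∧ t ≤ hi ∧ IsCandidate σ' t} j := by
  obtain ⟨⟨hlo, hhi, hcand⟩, hle⟩ := h
  refine ⟨⟨hlo, hhi, (isCandidate_congr le_rfl hσ).1 hcand⟩, fun t ht => ?_⟩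
  by_contra! htj
  exact htj.not_ge (hle ⟨ht.1, ht.2.1, (isCandidate_congr htj.le hσ).2 ht.2.2⟩)

lemma thresholdTimes_congr {σ' : Equiv.Perm (Fin n)} (hσ : history t σ = history t σ')
    {l : Fin k} (ht : thresholdTimes s b σ k i l = (t : WithTop ℕ)) :
    thresholdTimes s b σ' k i l = (t : WithTop ℕ) := by
  induction k generalizing i with
  | zero => exact l.elim0
  | succ k ih =>
    rcases thresholdTimes_eq_top_or_cons s b σ k i with h | ⟨j, hj, h⟩ <;> rw [h] at ht
    · exact absurd ht.symm (WithTop.coe_ne_top)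
    · have hjt : j ≤ t := by
        cases l using Fin.cases with
        | zero => exact (WithTop.coe_injective ht).le
        | succ l =>
          have hlt := (le_thresholdTimes σ k (j + 1) l).trans_eq ht
          exact Nat.le_of_succ_le (WithTop.coe_le_coe.1 hlt)
      rw [thresholdTimes_eq_cons (isLeast_isCandidate_congr (history_eq_of_le hjt hσ) hj)]
      cases l using Fin.cases with
      | zero => exact ht
      | succ l => exact ih ht

lemma isAdmissible_thresholdStrategy (s : ℕ → ℕ) (b k i : ℕ) :
    IsAdmissible k i (thresholdStrategy (n := n) s b k i) where
  stopping l t := by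
    refine measurableSet_rankFiltration_iff.2 fun σ σ' hσ => ?_
    intro (ht : thresholdTimes s b σ k i l ≤ t)
    obtain ⟨j, hj⟩ := WithTop.ne_top_iff_exists.1 (ht.trans_lt (WithTop.coe_lt_top t)).ne
    have hjt : j ≤ t := WithTop.coe_le_coe.1 (hj.trans_le ht)
    have hσ' := thresholdTimes_congr (history_eq_of_le hjt hσ) hj.symm
    exact hσ'.trans_le (WithTop.coe_le_coe.2 hjt)
  candidate _ _ _ := isCandidate_thresholdTimes
  start l σ := le_thresholdTimes σ k i l
  increasing _ _ _ := thresholdTimes_lt_or_eq_top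

lemma thresholdTimes_select (h : IsCandidate σ i) (his : s (k + 1) ≤ i) (hib : i ≤ b) :
    thresholdTimes s b σ (k + 1) i
      = Fin.cons (i : WithTop ℕ) (thresholdTimes s b σ k (i + 1)) :=
  thresholdTimes_eq_cons ⟨⟨max_le le_rfl his, hib, h⟩, fun _ ht => le_of_max_le_left ht.1⟩

lemma thresholdTimes_pass (h : ¬ (IsCandidate σ i ∧ s (k + 1) ≤ i ∧ i ≤ b)) :
    thresholdTimes s b σ (k + 1) i = thresholdTimes s b σ (k + 1) (i + 1) := by
  have hset : ∀ t, max i (s (k + 1)) ≤ t ∧ t ≤ b ∧ IsCandidate σ t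
      ↔ max (i + 1) (s (k + 1)) ≤ t ∧ t ≤ b ∧ IsCandidate σ t := by
    refine fun t => and_congr_left fun ⟨htb, hcand⟩ => ?_
    have hne : s (k + 1) ≤ t → i ≠ t := fun hst hit => h (hit ▸ ⟨hcand, hst, htb⟩)
    omega
  rw [thresholdTimes, thresholdTimes, firstCandidate, firstCandidate]
  simp only [hset]

lemma mean_sum_payoff_thresholdStrategy (hu : IsUnimodalPayoff n K N u)
    (hG : IsOneChoiceGain N u G) (hs : IsCriticalSequence N m G s) (hw : HasMeanPayoff w u)
    (hk : k ≤ m) (hi : 1 ≤ i) (hin : i ≤ n + 1) (σ₀ : Equiv.Perm (Fin n)) :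
    mean (sameHistory i σ₀) (fun σ => ∑ l, w σ (thresholdStrategy s N k i l σ))
      = stateValue u N G s k i σ₀ := by
  induction hin using Nat.decreasingInduction generalizing k σ₀ with
  | self =>
    have hτ := (isAdmissible_thresholdStrategy s N k (n + 1)).isAdmissibleOn
      (sameHistory (n + 1) σ₀)
    rw [mean_eq_of_forall (sameHistory_nonempty _ σ₀) fun σ => hτ.sum_payoff_eq_zero hw,
      stateValue_end hu.last_le]
  | of_succ i hlt ih =>
    have hin : i ≤ n := Nat.lt_succ_iff.1 hlt
    have hlater : ∀ k ≤ m,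
        mean (sameHistory i σ₀) (fun σ => ∑ l, w σ (thresholdTimes s N σ k (i + 1) l))
          = thresholdValue N G s k (i + 1) := by
      intro k hk
      have hsub := fun σ => sameHistory_subset (σ := σ) (σ₀ := σ₀) (Nat.le_succ i)
      rw [← mean_stateValue hu hG hs hk hin σ₀, ← mean_mean_sameHistory hsub]
      exact mean_congr fun σ _ => ih hk (Nat.le_add_left 1 i) σ
    cases k with
    | zero => exact mean_eq_of_forall (sameHistory_nonempty i σ₀) fun _ _ => rfl
    | succ k =>
      by_cases h : IsCandidate σ₀ i ∧ s (k + 1) ≤ i ∧ i ≤ N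
      · have hτ : ∀ σ ∈ sameHistory i σ₀, thresholdTimes s N σ (k + 1) i
            = Fin.cons (i : WithTop ℕ) (thresholdTimes s N σ k (i + 1)) := fun σ hσ =>
          thresholdTimes_select ((isCandidate_iff_of_mem_sameHistory hσ).2 h.1) h.2.1 h.2.2
        rw [stateValue_of_select hG hs hk h.1 h.2.1 h.2.2, ← hlater k (Nat.le_of_succ_le hk),
          mean_sum_payoff_of_select hw hi hin h.1 fun σ hσ => congrFun (hτ σ hσ) 0]
        congr 1
        exact mean_congr fun σ hσ => by simp only [thresholdStrategy, hτ σ hσ, Fin.cons_succ]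
      · rw [stateValue_of_pass hu hG hs hk hi hin h, ← hlater (k + 1) hk]
        refine mean_congr fun σ hσ => ?_
        rw [← thresholdTimes_pass fun hσi => h ⟨(isCandidate_iff_of_mem_sameHistory hσ).1 hσi.1,
          hσi.2⟩]
        rfl

theorem isGreatest_mean_thresholdStrategy (hu : IsUnimodalPayoff n K N u)
    (hG : IsOneChoiceGain N u G) (hs : IsCriticalSequence N m G s) (hw : HasMeanPayoff w u)
    (hk : k ≤ m) (hi : 1 ≤ i) (hin : i ≤ n) (σ₀ : Equiv.Perm (Fin n)) :
    IsGreatest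
      {v : ℝ | ∃ τ : Fin k → Equiv.Perm (Fin n) → WithTop ℕ,
        IsAdmissible k i τ ∧ v = mean (sameHistory i σ₀) (fun σ => ∑ l, w σ (τ l σ))}
      (mean (sameHistory i σ₀) (fun σ => ∑ l, w σ (thresholdStrategy s N k i l σ))) := by
  refine ⟨⟨_, isAdmissible_thresholdStrategy s N k i, rfl⟩, ?_⟩
  rintro _ ⟨τ, hτ, rfl⟩
  rw [mean_sum_payoff_thresholdStrategy hu hG hs hw hk hi (Nat.le_succ_of_le hin)]
  exact mean_sum_payoff_le_stateValue hu hG hs hw hk hi (Nat.le_succ_of_le hin) σ₀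
    (hτ.isAdmissibleOn _)

end Threshold

section Peak

variable {i : ℕ} {c : ℝ}

lemma isLeast_peakTime (hn : 1 ≤ n) :
    IsLeast {i : ℕ | 1 ≤ i ∧ (harmonic n : ℝ) - harmonic i ≤ 1} (peakTime n) :=
  ⟨Nat.sInf_mem ⟨n, hn, by rw [sub_self]; exact zero_le_one⟩, fun _ hi => Nat.sInf_le hi⟩

lemma harmonic_sub_le_one_iff (hn : 1 ≤ n) (hi : 1 ≤ i) :
    (harmonic n : ℝ) - harmonic i ≤ 1 ↔ peakTime n ≤ i := by
  have hmono : Monotone harmonic := monotone_nat_of_le_succ fun j => by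
    rw [harmonic_succ]
    exact le_add_of_nonneg_right (by positivity)
  refine ⟨fun h => (isLeast_peakTime hn).2 ⟨hi, h⟩, fun h => ?_⟩
  exact (sub_le_sub_left (Rat.cast_le.2 (hmono h)) _).trans (isLeast_peakTime hn).1.2

lemma peakTime_le (hn : 1 ≤ n) : peakTime n ≤ n :=
  (harmonic_sub_le_one_iff hn hn).1 (by rw [sub_self]; exact zero_le_one)

lemma monotoneOn_meanDuration (hn : 1 ≤ n) :
    MonotoneOn (meanDuration n) (Set.Icc 1 (peakTime n)) := by
  refine monotoneOn_of_le_add_one Set.ordConnected_Icc fun i _ hi hi' => ?_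
  have hstep := meanDuration_succ_sub hi.1 (Nat.lt_of_succ_le (hi'.2.trans (peakTime_le hn)))
  have hlt := lt_of_not_ge (mt (harmonic_sub_le_one_iff hn hi.1).1 (not_le.2 hi'.2))
  linarith

lemma antitoneOn_meanDuration (hn : 1 ≤ n) :
    AntitoneOn (meanDuration n) (Set.Icc (peakTime n) n) := by
  refine antitoneOn_of_add_one_le Set.ordConnected_Icc fun i _ hi hi' => ?_
  have hi1 := (isLeast_peakTime hn).1.1.trans hi.1
  have hstep := meanDuration_succ_sub hi1 (Nat.lt_of_succ_le hi'.2)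
  have hle := (harmonic_sub_le_one_iff hn hi1).2 hi.1
  linarith

lemma peakTime_mem (hn : 1 ≤ n) (hcU : c ≤ meanDuration n (peakTime n)) :
    peakTime n ∈ {i : ℕ | 1 ≤ i ∧ i ≤ n ∧ 0 ≤ meanDuration n i - c} :=
  ⟨(isLeast_peakTime hn).1.1, peakTime_le hn, sub_nonneg.2 hcU⟩

lemma isLeast_firstTime (hn : 1 ≤ n) (hcU : c ≤ meanDuration n (peakTime n)) :
    IsLeast {i : ℕ | 1 ≤ i ∧ i ≤ n ∧ 0 ≤ meanDuration n i - c} (firstTime n c) :=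
  ⟨Nat.sInf_mem ⟨_, peakTime_mem hn hcU⟩, fun _ hi => Nat.sInf_le hi⟩

lemma isGreatest_lastTime (hn : 1 ≤ n) (hcU : c ≤ meanDuration n (peakTime n)) :
    IsGreatest {i : ℕ | 1 ≤ i ∧ i ≤ n ∧ 0 ≤ meanDuration n i - c} (lastTime n c) := by
  have hbdd : BddAbove {i : ℕ | 1 ≤ i ∧ i ≤ n ∧ 0 ≤ meanDuration n i - c} :=
    ⟨n, fun _ hi => hi.2.1⟩
  exact ⟨Nat.sSup_mem ⟨_, peakTime_mem hn hcU⟩ hbdd, fun _ hi => le_csSup hbdd hi⟩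

lemma meanDuration_sub_nonneg_iff (hn : 1 ≤ n) (hcU : c ≤ meanDuration n (peakTime n))
    (hi : 1 ≤ i) (hin : i ≤ n) :
    0 ≤ meanDuration n i - c ↔ firstTime n c ≤ i ∧ i ≤ lastTime n c := by
  obtain ⟨⟨hf1, -, hfc⟩, hfle⟩ := isLeast_firstTime hn hcU
  obtain ⟨⟨-, hln, hlc⟩, hlle⟩ := isGreatest_lastTime hn hcU
  have hK := peakTime_mem hn hcU
  refine ⟨fun h => ⟨hfle ⟨hi, hin, h⟩, hlle ⟨hi, hin, h⟩⟩, fun ⟨hfi, hil⟩ => ?_⟩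
  rcases le_total i (peakTime n) with hiK | hKi
  · have := monotoneOn_meanDuration hn ⟨hf1, hfle hK⟩ ⟨hi, hiK⟩ hfi
    linarith
  · have := antitoneOn_meanDuration hn ⟨hKi, hin⟩ ⟨hlle hK, hln⟩ hil
    linarith

lemma isUnimodalPayoff_meanDuration_sub (hn : 1 ≤ n) (hcU : c ≤ meanDuration n (peakTime n)) :
    IsUnimodalPayoff n (peakTime n) (lastTime n c) fun i => meanDuration n i - c := by
  obtain ⟨⟨hl1, hln, hlc⟩, hlle⟩ := isGreatest_lastTime hn hcU
  have hK := peakTime_mem hn hcU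
  exact
    { one_le_peak := hK.1
      peak_le_last := hlle hK
      last_le := hln
      monotoneOn := fun i hi j hj hij =>
        sub_le_sub_right (monotoneOn_meanDuration hn hi hj hij) c
      antitoneOn := fun i hi j hj hij => sub_le_sub_right
        (antitoneOn_meanDuration hn ⟨hi.1, hi.2.trans hln⟩ ⟨hj.1, hj.2.trans hln⟩ hij) c
      last_nonneg := hlc
      nonpos := fun i hil hin => (not_le.1 fun h =>
        hil.not_ge (hlle ⟨hl1.trans hil.le, hin, h⟩)).le }

lemma isOneChoiceGain_acquisitionGain (hl1 : 1 ≤ lastTime n c) (hln : lastTime n c ≤ n) :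
    IsOneChoiceGain (lastTime n c) (fun i => meanDuration n i - c) (acquisitionGain n c) where
  last := by
    have hne : (lastTime n c : ℝ) ≠ 0 := Nat.cast_ne_zero.2 (Nat.pos_iff_ne_zero.1 hl1)
    rw [acquisitionGain, Icc_eq_empty (Nat.lt_succ_self _).not_ge, sum_empty, sub_zero, mul_sub,
      mul_div_cancel₀ _ hne, meanDuration_eq hl1 hln]
  step i hi hil := by
    have hne : (i : ℝ) ≠ 0 := Nat.cast_ne_zero.2 (Nat.pos_iff_ne_zero.1 hi)
    have hpred := mul_harmonic_sub_pred n hi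
    rw [sub_sub_sub_cancel_right, meanDuration_succ_sub hi (hil.trans_le hln), acquisitionGain,
      acquisitionGain, ← insert_Icc_add_one_left_eq_Icc (Nat.succ_le_of_lt hil),
      sum_insert (by simp), Nat.cast_succ, add_sub_cancel_right, Nat.add_sub_cancel]
    have hcancel : (i : ℝ) * (1 / i * (harmonic n - harmonic i)) = harmonic n - harmonic i := by
      field_simp
    linear_combination hcancel - hpred

lemma hasMeanPayoff_netPayoff (n : ℕ) (c : ℝ) :
    HasMeanPayoff (n := n) (netPayoff c) fun i => meanDuration n i - c where
  top _ := rfl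
  mean_coe i σ₀ hi hin _ := by
    change mean _ (fun σ => duration σ i + -c) = meanDuration n i + -c
    rw [mean_add, mean_const (sameHistory_nonempty i σ₀),
      mean_sameHistory_duration_eq_meanDuration hi hin]

end Peak

end DurationProblem

theorem theorem4_general (n m : ℕ) (hn : 1 ≤ n) (hm : 1 ≤ m) (c : ℝ)
    (hcU : c ≤ meanDuration n (peakTime n)) :
    (1 ≤ firstTime n c ∧ firstTime n c ≤ peakTime n ∧ peakTime n ≤ lastTime n c ∧
      lastTime n c ≤ n ∧
      ∀ i : ℕ, 1 ≤ i → i ≤ n →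
        (0 ≤ meanDuration n i - c ↔ firstTime n c ≤ i ∧ i ≤ lastTime n c)) ∧
    ∃ s : ℕ → ℕ,
      IsCriticalSequence (lastTime n c) m (acquisitionGain n c) s ∧
      AntitoneOn s (Set.Icc 1 m) ∧
      firstTime n c ≤ s m ∧
      IsGreatest
        {v : ℝ | ∃ τ : Fin m → Equiv.Perm (Fin n) → WithTop ℕ,
          IsAdmissible m 1 τ ∧ v = mean Finset.univ (totalPayoff c τ)}
        (mean Finset.univ
          (totalPayoff c (thresholdStrategy (n := n) s (lastTime n c) m 1))) ∧
      ∀ k : ℕ, 1 ≤ k → k ≤ m → ∀ i : ℕ, 1 ≤ i → i ≤ n → ∀ σ₀ : Equiv.Perm (Fin n),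
        IsGreatest
          {v : ℝ | ∃ τ : Fin k → Equiv.Perm (Fin n) → WithTop ℕ,
            IsAdmissible k i τ ∧ v = mean (sameHistory i σ₀) (totalPayoff c τ)}
          (mean (sameHistory i σ₀)
            (totalPayoff c (thresholdStrategy (n := n) s (lastTime n c) k i))) := by
  obtain ⟨⟨hf1, -⟩, hfle⟩ := isLeast_firstTime hn hcU
  obtain ⟨⟨hl1, hln, -⟩, hlle⟩ := isGreatest_lastTime hn hcU
  have hK := peakTime_mem hn hcU
  have hu := isUnimodalPayoff_meanDuration_sub hn hcU
  have hG := isOneChoiceGain_acquisitionGain hl1 hln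
  have hs := hG.isCriticalSequence hu m
  obtain ⟨hsm1, hsml, -⟩ := (hs.isLeast m hm le_rfl).1
  have hw := hasMeanPayoff_netPayoff n c
  refine ⟨⟨hf1, hfle hK, hlle hK, hln, fun i => meanDuration_sub_nonneg_iff hn hcU⟩, _, hs,
    hs.antitoneOn, hfle ⟨hsm1, hsml.trans hln, nonneg_apply_criticalSequence hG hs hm le_rfl⟩,
    ?_, fun k _ hk i => isGreatest_mean_thresholdStrategy hu hG hs hw hk⟩
  rw [← sameHistory_one 1]
  exact isGreatest_mean_thresholdStrategy hu hG hs hw le_rfl le_rfl hn 1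

theorem theorem4 (n m : ℕ) (hn : 1 < n) (hm : 1 ≤ m) (c : ℝ) (hc : 0 < c)
    (hcU : c < meanDuration n (peakTime n)) :
    -- the interval on which choosing a candidate has nonnegative mean net payoff
    (1 ≤ firstTime n c ∧ firstTime n c ≤ peakTime n ∧ peakTime n ≤ lastTime n c ∧
      lastTime n c ≤ n ∧
      ∀ i : ℕ, 1 ≤ i → i ≤ n →
        (0 ≤ meanDuration n i - c ↔ firstTime n c ≤ i ∧ i ≤ lastTime n c)) ∧
    ∃ s : ℕ → ℕ,
      IsCriticalSequence (lastTime n c) m (acquisitionGain n c) s ∧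
      AntitoneOn s (Set.Icc 1 m) ∧
      firstTime n c ≤ s m ∧
      -- the threshold strategy maximizes the expected net payoff
      IsGreatest
        {v : ℝ | ∃ τ : Fin m → Equiv.Perm (Fin n) → WithTop ℕ,
          IsAdmissible m 1 τ ∧ v = mean Finset.univ (totalPayoff c τ)}
        (mean Finset.univ
          (totalPayoff c (thresholdStrategy (n := n) s (lastTime n c) m 1))) ∧
      -- it does so at any time `i`, with any number `k` of choices left, after any observations
      ∀ k : ℕ, 1 ≤ k → k ≤ m → ∀ i : ℕ, 1 ≤ i → i ≤ n → ∀ σ₀ : Equiv.Perm (Fin n),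
        IsGreatest
          {v : ℝ | ∃ τ : Fin k → Equiv.Perm (Fin n) → WithTop ℕ,
            IsAdmissible k i τ ∧ v = mean (sameHistory i σ₀) (totalPayoff c τ)}
          (mean (sameHistory i σ₀)
            (totalPayoff c (thresholdStrategy (n := n) s (lastTime n c) k i))) :=
  theorem4_general n m hn.le hm c hcU.le
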